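/- A \emph{partial lattice} is a nonempty partially ordered set $(P,\leq)$ with two partial functions $\bigvee,\bigwedge$ from the set of nonempty finite subsets of $P$ to $P$ such that $a=\bigvee X$ implies that $a$ is the least upper bound of $X$, and $a=\bigwedge X$ implies that $a$ is the greatest lower bound of $X$. A \emph{congruence} of $P$ is a quasi-ordering $\preceq$ of $P$ containing $\leq$ such that $a=\bigvee X$ implies that $a$ is a supremum of $X$ with respect to $\preceq$, and $a=\bigwedge X$ implies that $a$ is an infimum of $X$ with respect to $\preceq$. Ordered by inclusion, the congruences of $P$ form a complete lattice $\operatorname{Con}P$, and $\operatorname{Con_c}P$ denotes the $(\vee,0)$-semilattice of its compact elements. Every nonempty lattice is viewed as a partial lattice in which $\bigvee X$ and $\bigwedge X$ are defined for all nonempty finite $X$. A \emph{homomorphism} $f\colon P\to Q$ of partial lattices is an order-preserving map such that $a=\bigvee X$ implies $f(a)=\bigvee f[X]$ and $a=\bigwedge X$ implies $f(a)=\bigwedge f[X]$; the map $\operatorname{Con_c}f\colon\operatorname{Con_c}P\to\operatorname{Con_c}Q$ sends $\boldsymbol{a}$ to the least congruence of $Q$ containing all pairs $(f(x),f(y))$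 with $(x,y)\in\boldsymbol{a}$. For a $(\vee,0)$-semilattice $S$, a $(\vee,0)$-homomorphism $\varphi\colon\operatorname{Con_c}P\to S$ \emph{can be lifted} if there are a lattice $L$, a homomorphism $f\colon P\to L$ of partial lattices, and an isomorphism $\psi\colon\operatorname{Con_c}L\to S$ such that $\varphi=\psi\circ\operatorname{Con_c}f$. Proposition. Let $S$ be a $(\vee,0)$-semilattice such that, for every partial lattice $P$, every $(\vee,0)$-homomorphism $\varphi\colon\operatorname{Con_c}P\to S$ can be lifted. Then $S$ is a conditionally complete lattice, that is, $S$ is a lattice and every nonempty subset of $S$ that has an upper bound has a least upper bound. -/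

import Mathlib

universe u v w

/-- The set of all nonempty finite subsets of `P`. -/
abbrev FinePow (P : Type u) : Type u := {X : Set P // X.Nonempty ∧ X.Finite}

namespace FinePow

/-- The image `f[X]` of a nonempty finite set `X`. -/
def image {P : Type u} {Q : Type v} (f : P → Q) (X : FinePow P) : FinePow Q :=
  ⟨f '' X.1, X.2.1.image f, X.2.2.image f⟩

end FinePow

/-- `⟨P, r, join, meet⟩` is a partial prelattice: `r` is a quasi-ordering, and `join`, `meet` are
partial functions from the nonempty finite subsets of `P` to `P` such that `a = join X` implies that
`a` is a supremum of `X` with respect to `r`, and dually for `meet`.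
(Nonemptiness of `P` is part of `PartialLattice` below.) -/
structure IsPartialPrelattice {P : Type u} (r : P → P → Prop) (join meet : FinePow P →. P) :
    Prop where
  refl : ∀ x, r x x
  trans : ∀ x y z, r x y → r y z → r x z
  sup_of_mem_join : ∀ (X : FinePow P) (a : P), a ∈ join X →
    (∀ x ∈ X.1, r x a) ∧ ∀ b, (∀ x ∈ X.1, r x b) → r a b
  inf_of_mem_meet : ∀ (X : FinePow P) (a : P), a ∈ meet X →
    (∀ x ∈ X.1, r a x) ∧ ∀ b, (∀ x ∈ X.1, r b x) → r b a

/-- A partial lattice: a nonempty partial prelattice whose quasi-ordering is antisymmetric. -/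
class PartialLattice (P : Type u) extends PartialOrder P where
  nonempty : Nonempty P
  join : FinePow P →. P
  meet : FinePow P →. P
  isPartialPrelattice : IsPartialPrelattice (fun x y : P => x ≤ y) join meet

/-- A nonempty lattice, viewed as a partial lattice in which all joins and meets of nonempty finite
subsets are defined. -/
noncomputable abbrev Lattice.toPartialLattice (L : Type u) [Lattice L] [Nonempty L] :
    PartialLattice L where
  nonempty := inferInstance
  join := fun X => Part.some
    (X.2.2.toFinset.sup' ((Set.Finite.toFinset_nonempty X.2.2).2 X.2.1) id)
  meet := fun X => Part.some
    (X.2.2.toFinset.inf' ((Set.Finite.toFinset_nonempty X.2.2).2 X.2.1) id)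
  isPartialPrelattice :=
    { refl := fun x => le_refl x
      trans := fun _ _ _ h₁ h₂ => le_trans h₁ h₂
      sup_of_mem_join := by
        intro X a ha
        rw [Part.mem_some_iff] at ha
        subst ha
        refine ⟨fun x hx => ?_, fun b hb => ?_⟩
        · exact Finset.le_sup' id ((Set.Finite.mem_toFinset X.2.2).2 hx)
        · exact Finset.sup'_le _ _ fun x hx => hb x ((Set.Finite.mem_toFinset X.2.2).1 hx)
      inf_of_mem_meet := by
        intro X a ha
        rw [Part.mem_some_iff] at ha
        subst ha
        refine ⟨fun x hx => ?_, fun b hb => ?_⟩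
        · exact Finset.inf'_le id ((Set.Finite.mem_toFinset X.2.2).2 hx)
        · exact Finset.le_inf' _ _ fun x hx => hb x ((Set.Finite.mem_toFinset X.2.2).1 hx) }

/-- A homomorphism of partial lattices: an order-preserving map such that `a = ⋁ X` implies
`f a = ⋁ f[X]`, and `a = ⋀ X` implies `f a = ⋀ f[X]`. -/
structure PartialLatticeHom (P : Type u) (Q : Type v) [PartialLattice P] [PartialLattice Q] where
  toFun : P → Q
  monotone : ∀ x y, x ≤ y → toFun x ≤ toFun y
  map_join : ∀ (X : FinePow P) (a : P), a ∈ PartialLattice.join X →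
    toFun a ∈ PartialLattice.join (X.image toFun)
  map_meet : ∀ (X : FinePow P) (a : P), a ∈ PartialLattice.meet X →
    toFun a ∈ PartialLattice.meet (X.image toFun)

/-- A congruence of a partial lattice `P`: a quasi-ordering of `P` containing `≤` which, together
with the given partial operations, makes `P` a partial prelattice. -/
@[ext]
structure PLCon (P : Type u) [PartialLattice P] where
  rel : P → P → Prop
  le_rel : ∀ x y, x ≤ y → rel x y
  isPartialPrelattice :
    IsPartialPrelattice rel (PartialLattice.join (P := P)) (PartialLattice.meet (P := P))

namespace PLCon

/-- Congruences are ordered by inclusion. -/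
instance {P : Type u} [PartialLattice P] : PartialOrder (PLCon P) where
  le a b := ∀ x y, a.rel x y → b.rel x y
  le_refl _ _ _ h := h
  le_trans _ _ _ h₁ h₂ x y h := h₂ x y (h₁ x y h)
  le_antisymm a b h₁ h₂ := by
    ext x y
    exact ⟨h₁ x y, h₂ x y⟩

/-- The intersection of a set of congruences. -/
instance {P : Type u} [PartialLattice P] : InfSet (PLCon P) where
  sInf s :=
    { rel := fun x y => ∀ c ∈ s, c.rel x y
      le_rel := fun x y h c _ => c.le_rel x y h
      isPartialPrelattice :=
        { refl := fun x c _ => c.isPartialPrelattice.refl x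
          trans := fun x y z h₁ h₂ c hc => c.isPartialPrelattice.trans x y z (h₁ c hc) (h₂ c hc)
          sup_of_mem_join := fun X a ha =>
            ⟨fun x hx c _ => (c.isPartialPrelattice.sup_of_mem_join X a ha).1 x hx,
              fun b hb c hc => (c.isPartialPrelattice.sup_of_mem_join X a ha).2 b
                fun x hx => hb x hx c hc⟩
          inf_of_mem_meet := fun X a ha =>
            ⟨fun x hx c _ => (c.isPartialPrelattice.inf_of_mem_meet X a ha).1 x hx,
              fun b hb c hc => (c.isPartialPrelattice.inf_of_mem_meet X a ha).2 b
                fun x hx => hb x hx c hc⟩ } }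

/-- The lattice `Con P` of all congruences of `P`. -/
instance {P : Type u} [PartialLattice P] : CompleteLattice (PLCon P) :=
  completeLatticeOfInf (PLCon P) fun _ =>
    ⟨fun _ hc _ _ h => h _ hc, fun _ hb x y h _ hc => hb hc x y h⟩

/-- The map `Con f`, which sends a congruence `a` of `P` to the least congruence of `Q` containing
all pairs `(f x, f y)` with `(x, y)` in `a`. -/
def map {P : Type u} {Q : Type v} [PartialLattice P] [PartialLattice Q]
    (f : PartialLatticeHom P Q) (a : PLCon P) : PLCon Q :=
  sInf {c | ∀ x y, a.rel x y → c.rel (f.toFun x) (f.toFun y)}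

/-- The map `Res f`, which sends a congruence of `Q` to its inverse image under `f`. -/
def res {P : Type u} {Q : Type v} [PartialLattice P] [PartialLattice Q]
    (f : PartialLatticeHom P Q) (b : PLCon Q) : PLCon P where
  rel x y := b.rel (f.toFun x) (f.toFun y)
  le_rel x y h := b.le_rel _ _ (f.monotone x y h)
  isPartialPrelattice :=
    { refl := fun x => b.isPartialPrelattice.refl _
      trans := fun x y z h₁ h₂ => b.isPartialPrelattice.trans _ _ _ h₁ h₂
      sup_of_mem_join := fun X a ha => by
        have h := b.isPartialPrelattice.sup_of_mem_join _ _ (f.map_join X a ha)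
        refine ⟨fun x hx => h.1 _ ⟨x, hx, rfl⟩, fun c hc => h.2 _ ?_⟩
        rintro _ ⟨x, hx, rfl⟩
        exact hc x hx
      inf_of_mem_meet := fun X a ha => by
        have h := b.isPartialPrelattice.inf_of_mem_meet _ _ (f.map_meet X a ha)
        refine ⟨fun x hx => h.1 _ ⟨x, hx, rfl⟩, fun c hc => h.2 _ ?_⟩
        rintro _ ⟨x, hx, rfl⟩
        exact hc x hx }

theorem map_le_iff {P : Type u} {Q : Type v} [PartialLattice P] [PartialLattice Q]
    (f : PartialLatticeHom P Q) (a : PLCon P) (b : PLCon Q) : map f a ≤ b ↔ a ≤ res f b :=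
  ⟨fun h x y hxy => h _ _ fun _ hc => hc x y hxy, fun h _ _ hxy => hxy b h⟩

/-- A finite set of pairs related by members of a directed family is related by one member. -/
theorem exists_of_directedOn {P : Type u} [PartialLattice P] {ι : Type w} {s : Set (PLCon P)}
    (hne : s.Nonempty) (hs : DirectedOn (· ≤ ·) s) {X : Set ι} (hX : X.Finite) (g h : ι → P)
    (H : ∀ i ∈ X, ∃ c ∈ s, c.rel (g i) (h i)) : ∃ c ∈ s, ∀ i ∈ X, c.rel (g i) (h i) := by
  induction X, hX using Set.Finite.induction_on with
  | empty => exact ⟨hne.choose, hne.choose_spec, fun i hi => hi.elim⟩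
  | insert _ _ ih =>
    obtain ⟨c, hc, hc'⟩ := ih fun i hi => H i (Set.mem_insert_of_mem _ hi)
    obtain ⟨d, hd, hd'⟩ := H _ (Set.mem_insert _ _)
    obtain ⟨e, he, hce, hde⟩ := hs c hc d hd
    refine ⟨e, he, fun i hi => ?_⟩
    rcases Set.mem_insert_iff.1 hi with rfl | hi
    · exact hde _ _ hd'
    · exact hce _ _ (hc' i hi)

/-- The union of a nonempty directed set of congruences is a congruence. -/
def directedUnion {P : Type u} [PartialLattice P] (s : Set (PLCon P))
    (hne : s.Nonempty) (hs : DirectedOn (· ≤ ·) s) : PLCon P where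
  rel x y := ∃ c ∈ s, c.rel x y
  le_rel x y h := ⟨hne.choose, hne.choose_spec, hne.choose.le_rel x y h⟩
  isPartialPrelattice :=
    { refl := fun x => ⟨hne.choose, hne.choose_spec, hne.choose.isPartialPrelattice.refl x⟩
      trans := by
        rintro x y z ⟨c, hc, hxy⟩ ⟨d, hd, hyz⟩
        obtain ⟨e, he, hce, hde⟩ := hs c hc d hd
        exact ⟨e, he, e.isPartialPrelattice.trans x y z (hce _ _ hxy) (hde _ _ hyz)⟩
      sup_of_mem_join := fun X a ha => by
        refine ⟨fun x hx => ⟨hne.choose, hne.choose_spec,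
          (hne.choose.isPartialPrelattice.sup_of_mem_join X a ha).1 x hx⟩, fun b hb => ?_⟩
        obtain ⟨c, hc, h⟩ := exists_of_directedOn hne hs X.2.2 (fun x => x) (fun _ => b) hb
        exact ⟨c, hc, (c.isPartialPrelattice.sup_of_mem_join X a ha).2 b h⟩
      inf_of_mem_meet := fun X a ha => by
        refine ⟨fun x hx => ⟨hne.choose, hne.choose_spec,
          (hne.choose.isPartialPrelattice.inf_of_mem_meet X a ha).1 x hx⟩, fun b hb => ?_⟩
        obtain ⟨c, hc, h⟩ := exists_of_directedOn hne hs X.2.2 (fun _ => b) (fun x => x) hb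
        exact ⟨c, hc, (c.isPartialPrelattice.inf_of_mem_meet X a ha).2 b h⟩ }

theorem isCompactElement_map {P : Type u} {Q : Type v} [PartialLattice P] [PartialLattice Q]
    (f : PartialLatticeHom P Q) {a : PLCon P} (ha : IsCompactElement a) :
    IsCompactElement (map f a) := by
  intro s b hne hs hb hab
  have hdir : DirectedOn (· ≤ ·) (res f '' s) := by
    rintro _ ⟨c, hc, rfl⟩ _ ⟨d, hd, rfl⟩
    obtain ⟨e, he, hce, hde⟩ := hs c hc d hd
    exact ⟨res f e, ⟨e, he, rfl⟩, fun x y h => hce _ _ h, fun x y h => hde _ _ h⟩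
  have hle : b ≤ directedUnion s hne hs := hb.2 fun c hc x y h => ⟨c, hc, h⟩
  have hlub : IsLUB (res f '' s) (directedUnion _ (hne.image (res f)) hdir) := by
    refine ⟨fun c hc x y h => ⟨c, hc, h⟩, fun d hd => ?_⟩
    rintro x y ⟨c, hc, h⟩
    exact hd hc x y h
  obtain ⟨_, ⟨c, hc, rfl⟩, h⟩ := ha _ _ (hne.image (res f)) hdir hlub (by
    intro x y hxy
    obtain ⟨c, hc, h⟩ := hle _ _ ((map_le_iff f a b).1 hab x y hxy)
    exact ⟨res f c, ⟨c, hc, rfl⟩, h⟩)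
  exact ⟨c, hc, (map_le_iff f a c).2 h⟩

end PLCon

/-- The semilattice `Con_c P` of all compact congruences of `P`. -/
def Conc (P : Type u) [PartialLattice P] : Type u := {a : PLCon P // IsCompactElement a}

namespace Conc

/-- The order, join and zero of `Con_c P` are those of `Con P`. -/
instance {P : Type u} [PartialLattice P] : SemilatticeSup (Conc P) :=
  Subtype.semilatticeSup (P := fun a : PLCon P => IsCompactElement a) (by
    intro a b ha hb s c hne hs hc hab
    obtain ⟨x, hx, hax⟩ := ha s c hne hs hc (le_sup_left.trans hab)
    obtain ⟨y, hy, hby⟩ := hb s c hne hs hc (le_sup_right.trans hab)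
    obtain ⟨z, hz, hxz, hyz⟩ := hs x hx y hy
    exact ⟨z, hz, sup_le (hax.trans hxz) (hby.trans hyz)⟩)

instance {P : Type u} [PartialLattice P] : OrderBot (Conc P) :=
  Subtype.orderBot (p := fun a : PLCon P => IsCompactElement a)
    (fun _ _ hne _ _ _ => ⟨hne.choose, hne.choose_spec, bot_le⟩)

/-- The map `Con_c f`, the restriction of `Con f` to compact congruences. -/
def map {P : Type u} {Q : Type v} [PartialLattice P] [PartialLattice Q]
    (f : PartialLatticeHom P Q) (a : Conc P) : Conc Q :=
  ⟨PLCon.map f a.1, PLCon.isCompactElement_map f a.2⟩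

end Conc

/-- A `(∨, 0)`-homomorphism `φ : Con_c P → S` can be lifted (through a lattice): there are a lattice
`L`, a homomorphism `f : P → L` of partial lattices, and an isomorphism `ψ : Con_c L → S` such that
`φ = ψ ∘ Con_c f`. The lattice `L` may live in any prescribed universe `w`. -/
def CanBeLifted {P : Type u} [PartialLattice P] {S : Type v} [SemilatticeSup S] [OrderBot S]
    (φ : SupBotHom (Conc P) S) : Prop :=
  ∃ (L : Type w) (_ : Lattice L) (_ : Nonempty L),
    letI : PartialLattice L := Lattice.toPartialLattice L
    ∃ (f : PartialLatticeHom P L) (ψ : Conc L ≃o S), ∀ a : Conc P, φ a = ψ (Conc.map f a)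

/-- A partially ordered set is conditionally complete if every nonempty majorized subset has a least
upper bound. -/
def IsConditionallyComplete (S : Type u) [PartialOrder S] : Prop :=
  ∀ X : Set S, X.Nonempty → BddAbove X → ∃ s, IsLUB X s

/-!
It suffices to interpolate: whenever `A, B ⊆ S` are bounded by some `e` and every element of `A` is
below every element of `B`, some `c` satisfies `A ≤ c ≤ B`. Binary meets come from `B = {a, b}` and
the set `A` of its lower bounds, and with meets at hand the least upper bound of `A` comes from
the set `B` of the upper bounds of `A` below a given one.

For the interpolation, let `P` consist of a least element `o`, two incomparable elements `x`, `y`,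
elements `u a ≤ x, y` for `a ∈ A`, and elements `t b` for `b ∈ B`, the only operations defined being
`t b ∧ y = o`. The meet `x ∧ y` is *not* defined in `P`, but it exists in every lattice `L`
receiving `P`, and there the congruence identifying `x ∧ y` with `o` lies above the one collapsing
`u a` to `o` (since `u a ≤ x ∧ y`), and below the one forcing `x` under `t b` (which puts `x ∧ y`
under `t b ∧ y = o`). If a lifted homomorphism sends these two congruences of `P` to `a` and `b`,
the image in `S` of the congruence of `L` in the middle is the required `c`.

A homomorphism with these values is given by an `S`-valued quasi-metric `d` on `P` compatible with
the operations: the relations `d p q ≤ s` are congruences, and each compact congruence `θ` is sent to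
the least `s` such that `θ` is contained in `d p q ≤ s` (`exists_supBotHom_of_rel_iff`).
-/

/-! ### Principal congruences and homomorphisms defined on compact congruences -/

namespace PLCon

variable {P : Type u} [PartialLattice P]

/-- The least congruence `≼` with `p ≼ q`. -/
def principal (p q : P) : PLCon P := sInf {c | c.rel p q}

theorem principal_le_iff {p q : P} {c : PLCon P} : principal p q ≤ c ↔ c.rel p q :=
  ⟨fun h => h p q fun _ hc => hc, fun h _ _ hxy => hxy c h⟩

theorem principal_rel (p q : P) : (principal p q).rel p q := principal_le_iff.1 le_rfl

theorem isCompactElement_principal (p q : P) : IsCompactElement (principal p q) := by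
  intro s b hne hs hb hpq
  have hle : b ≤ directedUnion s hne hs := hb.2 fun c hc x y h => ⟨c, hc, h⟩
  obtain ⟨c, hc, h⟩ := hle _ _ (principal_le_iff.1 hpq)
  exact ⟨c, hc, principal_le_iff.2 h⟩

theorem map_principal {Q : Type v} [PartialLattice Q] (f : PartialLatticeHom P Q) (p q : P) :
    map f (principal p q) = principal (f.toFun p) (f.toFun q) :=
  eq_of_forall_ge_iff fun c => by
    rw [map_le_iff, principal_le_iff, principal_le_iff]
    rfl

/-- A property of congruences that holds for the least congruence and for principal congruences and
is preserved by binary joins holds for all compact congruences. -/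
theorem compact_induction {motive : PLCon P → Prop} (bot : motive ⊥)
    (principal : ∀ p q, motive (principal p q))
    (sup : ∀ a b, motive a → motive b → motive (a ⊔ b)) {θ : PLCon P}
    (hθ : IsCompactElement θ) : motive θ := by
  obtain ⟨c, ⟨hc, hcθ⟩, hθc⟩ := hθ {c | motive c ∧ c ≤ θ} θ ⟨⊥, bot, bot_le⟩
    (fun a ha b hb => ⟨a ⊔ b, ⟨sup a b ha.1 hb.1, sup_le ha.2 hb.2⟩, le_sup_left, le_sup_right⟩)
    ⟨fun c hc => hc.2, fun c hc p q hpq =>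
      principal_le_iff.1 (hc ⟨principal p q, principal_le_iff.2 hpq⟩)⟩ le_rfl
  exact le_antisymm hcθ hθc ▸ hc

/-- If every pair `(p, q)` lies in exactly the congruences `ρ s` with `d p q ≤ s`, then `ρ` is the
right adjoint of a homomorphism `Con_c P → S`: the least `s` with `θ ≤ ρ s` exists for principal
`θ`, hence for finite joins of these. -/
theorem exists_supBotHom_of_rel_iff {S : Type v} [SemilatticeSup S] [OrderBot S]
    (ρ : S → PLCon P) (d : P → P → S) (hd : ∀ s p q, (ρ s).rel p q ↔ d p q ≤ s) :
    ∃ φ : SupBotHom (Conc P) S, ∀ θ s, φ θ ≤ s ↔ θ.1 ≤ ρ s := by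
  have key : ∀ θ : Conc P, ∃ m : S, ∀ s, m ≤ s ↔ θ.1 ≤ ρ s := fun θ => by
    refine compact_induction (motive := fun θ => ∃ m : S, ∀ s, m ≤ s ↔ θ ≤ ρ s)
      ⟨⊥, fun s => by simp⟩ (fun p q => ⟨d p q, fun s => by rw [principal_le_iff, hd]⟩) ?_ θ.2
    rintro a b ⟨m, hm⟩ ⟨n, hn⟩
    exact ⟨m ⊔ n, fun s => by rw [sup_le_iff, sup_le_iff, hm, hn]⟩
  choose φ hφ using key
  refine ⟨⟨⟨φ, fun a b => eq_of_forall_ge_iff fun s => ?_⟩, le_bot_iff.1 ?_⟩, hφ⟩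
  · rw [sup_le_iff, hφ, hφ, hφ]
    exact sup_le_iff (a := a.1) (b := b.1)
  · exact (hφ _ _).2 bot_le

end PLCon

namespace Conc

variable {P : Type u} [PartialLattice P]

/-- The least congruence `≼` with `p ≼ q`, as a compact congruence. -/
def principal (p q : P) : Conc P := ⟨.principal p q, PLCon.isCompactElement_principal p q⟩

theorem principal_le_iff {p q : P} {c : Conc P} : principal p q ≤ c ↔ c.1.rel p q :=
  PLCon.principal_le_iff

theorem map_principal {Q : Type v} [PartialLattice Q] (f : PartialLatticeHom P Q) (p q : P) :
    map f (principal p q) = principal (f.toFun p) (f.toFun q) :=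
  Subtype.ext (PLCon.map_principal f p q)

end Conc

/-! ### The partial lattice for the interpolation -/

/-- The partial lattice with least element `o`, with `u a ≤ x, y` for `a ∈ A`, and with `t b ∧ y = o`
for `b ∈ B`. -/
inductive Interpolant {S : Type u} (A B : Set S) : Type u
  | o : Interpolant A B
  | x : Interpolant A B
  | y : Interpolant A B
  | u : A → Interpolant A B
  | t : B → Interpolant A B

namespace Interpolant

variable {S : Type u} {A B : Set S}

/-- The partial ordering of `Interpolant A B`. -/
inductive Le : Interpolant A B → Interpolant A B → Prop
  | refl (p) : Le p p
  | o_le (p) : Le o p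
  | u_le_x (a) : Le (u a) x
  | u_le_y (a) : Le (u a) y

instance : PartialOrder (Interpolant A B) where
  le := Le
  le_refl := Le.refl
  le_trans p q r h₁ h₂ := by
    cases h₁ <;> first | exact h₂ | exact .o_le _ | (cases h₂; constructor)
  le_antisymm p q h₁ h₂ := by
    cases h₁ <;> cases h₂ <;> rfl

theorem le_t_iff {p : Interpolant A B} {b : B} : p ≤ t b ↔ p = t b ∨ p = o := by
  constructor
  · rintro (_ | _) <;> simp
  · rintro (rfl | rfl) <;> constructor

theorem not_t_le_y (b : B) : ¬ (t b : Interpolant A B) ≤ y := by rintro ⟨⟩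

instance : PartialLattice (Interpolant A B) where
  nonempty := ⟨o⟩
  join _ := Part.none
  meet X := ⟨∃ b, X.1 = {t b, y}, fun _ => o⟩
  isPartialPrelattice :=
    { refl := le_refl
      trans := fun _ _ _ => le_trans
      sup_of_mem_join := fun _ _ h => absurd h (Part.notMem_none _)
      inf_of_mem_meet := by
        rintro ⟨X, hX⟩ _ ⟨⟨b, rfl : X = _⟩, rfl⟩
        refine ⟨fun p _ => Le.o_le p, fun p hp => ?_⟩
        rcases le_t_iff.1 (hp (t b) (by simp)) with rfl | rfl
        · exact absurd (hp y (by simp)) (not_t_le_y b)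
        · exact Le.o_le _ }

theorem o_mem_meet (b : B) :
    (o : Interpolant A B) ∈
      PartialLattice.meet (⟨{t b, y}, by simp, by simp⟩ : FinePow (Interpolant A B)) :=
  ⟨⟨b, rfl⟩, rfl⟩

section QDist

variable [SemilatticeSup S] [OrderBot S]

open Classical in
/-- The `S`-valued quasi-metric on `Interpolant A B`, where `qdist e p q` measures how far `p` is from
being below `q`: it is `a` from `u a` to `o` and `b` from `x` to `t b`, and otherwise as large as
these values and the bound `e` permit. -/
noncomputable def qdist (e : S) (p q : Interpolant A B) : S :=
  if p ≤ q then ⊥ else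
    match p, q with
    | u a, _ => a
    | x, t b => b
    | _, _ => e

theorem qdist_of_le (e : S) {p q : Interpolant A B} (h : p ≤ q) : qdist e p q = ⊥ := if_pos h

theorem qdist_u_o (e : S) (a : A) : qdist e (u a : Interpolant A B) o = a :=
  if_neg (by rintro ⟨⟩)

theorem qdist_x_t (e : S) (b : B) : qdist e (x : Interpolant A B) (t b) = b :=
  if_neg (by rintro ⟨⟩)

theorem qdist_le {e : S} (hA : ∀ a ∈ A, a ≤ e) (hB : ∀ b ∈ B, b ≤ e) (p q : Interpolant A B) :
    qdist e p q ≤ e := by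
  unfold qdist
  split_ifs
  · exact bot_le
  · split
    · exact hA _ (Subtype.prop _)
    · exact hB _ (Subtype.prop _)
    · exact le_rfl

theorem qdist_triangle {e : S} (hA : ∀ a ∈ A, a ≤ e) (hB : ∀ b ∈ B, b ≤ e)
    (hAB : ∀ a ∈ A, ∀ b ∈ B, a ≤ b) (p q r : Interpolant A B) :
    qdist e p r ≤ qdist e p q ⊔ qdist e q r := by
  have hle := qdist_le hA hB p r
  by_cases hpr : p ≤ r
  · simp [qdist_of_le e hpr]
  by_cases hpq : p ≤ q
  · rcases hpq with _ | _ | a | a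
    · exact le_sup_right
    · exact absurd (Le.o_le r) hpr
    · -- Through `x`, the distance from `u a` is `a`, while that from `x` is some `b ∈ B` or `e`:
      -- this is where `A ≤ B` is needed.
      refine le_sup_of_le_right ?_
      have hxr : ¬ (x : Interpolant A B) ≤ r := fun h => hpr (le_trans (Le.u_le_x a) h)
      cases r <;> simp only [qdist, if_neg hpr, if_neg hxr]
      all_goals first | exact hA _ a.2 | exact hAB _ a.2 _ (Subtype.prop _)
    · refine le_sup_of_le_right ?_
      have hyr : ¬ (y : Interpolant A B) ≤ r := fun h => hpr (le_trans (Le.u_le_y a) h)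
      simp only [qdist, if_neg hpr, if_neg hyr]
      exact hA _ a.2
  · by_cases hqr : q ≤ r
    · rcases hqr with _ | _ | a | a
      · exact le_sup_left
      all_goals
        refine le_sup_of_le_left ?_
        cases p <;> simp only [qdist, if_neg hpr, if_neg hpq] at hle ⊢ <;>
          first | exact hle | exact le_rfl
    · -- Distances from `u a` are at most `a`, from `x` to `t b` exactly `b`; all others are `e`.
      cases p <;> cases q <;> simp only [qdist, if_neg hpr, if_neg hpq, if_neg hqr] at hle ⊢ <;>
        first | exact le_sup_of_le_left hle | exact le_sup_of_le_right hle | exact le_sup_left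

/-- The quasi-metric is compatible with the meet `t b ∧ y = o`. -/
theorem qdist_o_le {e : S} (p : Interpolant A B) (b : B) :
    qdist e p o ≤ qdist e p (t b) ⊔ qdist e p y := by
  by_cases ho : p ≤ o
  · simp [qdist_of_le e ho]
  by_cases ht : p ≤ t b
  · rcases le_t_iff.1 ht with rfl | rfl
    · refine le_sup_of_le_right ?_
      simp only [qdist, if_neg ho, if_neg (not_t_le_y b), le_refl]
    · exact absurd (Le.o_le o) ho
  · cases p with
    | o => exact absurd (Le.o_le _) ho
    | x =>
      refine le_sup_of_le_right ?_
      have hy : ¬ (x : Interpolant A B) ≤ y := by rintro ⟨⟩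
      simp only [qdist, if_neg ho, if_neg hy, le_refl]
    | _ =>
      refine le_sup_of_le_left ?_
      simp only [qdist, if_neg ho, if_neg ht, le_refl]

/-- The congruence of `Interpolant A B` consisting of the pairs at distance at most `s`. -/
noncomputable def con {e : S} (hA : ∀ a ∈ A, a ≤ e) (hB : ∀ b ∈ B, b ≤ e)
    (hAB : ∀ a ∈ A, ∀ b ∈ B, a ≤ b) (s : S) : PLCon (Interpolant A B) where
  rel p q := qdist e p q ≤ s
  le_rel p q h := by simp [qdist_of_le e h]
  isPartialPrelattice :=
    { refl := fun p => by simp [qdist_of_le e (le_refl p)]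
      trans := fun p q r h₁ h₂ => (qdist_triangle hA hB hAB p q r).trans (sup_le h₁ h₂)
      sup_of_mem_join := fun _ _ h => absurd h (Part.notMem_none _)
      inf_of_mem_meet := by
        rintro ⟨X, hX⟩ _ ⟨⟨b, rfl : X = _⟩, rfl⟩
        refine ⟨fun p _ => (qdist_of_le e (Le.o_le p)).trans_le bot_le, fun p hp => ?_⟩
        exact (qdist_o_le p b).trans (sup_le (hp _ (Or.inl rfl)) (hp _ (Or.inr rfl))) }

end QDist

end Interpolant

/-! ### Interpolation in a semilattice with liftings -/

open Interpolant in
/-- The middle element `c` is the image of the congruence of the lifting lattice `L` generated by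
`x ∧ y ≼ o`, which has no counterpart in the partial lattice. -/
theorem exists_between_of_canBeLifted {S : Type u} [SemilatticeSup S] [OrderBot S]
    (h : ∀ (P : Type u) [PartialLattice P] (φ : SupBotHom (Conc P) S), CanBeLifted.{u, u, w} φ)
    {A B : Set S} {e : S} (hA : ∀ a ∈ A, a ≤ e) (hB : ∀ b ∈ B, b ≤ e)
    (hAB : ∀ a ∈ A, ∀ b ∈ B, a ≤ b) : ∃ c, (∀ a ∈ A, a ≤ c) ∧ ∀ b ∈ B, c ≤ b := by
  obtain ⟨φ, hφ⟩ := PLCon.exists_supBotHom_of_rel_iff (con hA hB hAB) (qdist e) fun _ _ _ => Iff.rfl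
  obtain ⟨L, _, _, H⟩ := h _ φ
  let _ : PartialLattice L := Lattice.toPartialLattice L
  obtain ⟨f, ψ, hψ⟩ := H
  have hprin : ∀ p q : Interpolant A B,
      ψ (.principal (f.toFun p) (f.toFun q)) = qdist e p q := fun p q => by
    rw [← Conc.map_principal, ← hψ]
    exact eq_of_forall_ge_iff fun s => by
      rw [hφ]
      exact PLCon.principal_le_iff
  refine ⟨ψ (.principal (f.toFun x ⊓ f.toFun y) (f.toFun o)), fun a ha => ?_, fun b hb => ?_⟩
  · have hle : Conc.principal (f.toFun (u ⟨a, ha⟩)) (f.toFun o) ≤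
        .principal (f.toFun x ⊓ f.toFun y) (f.toFun o) :=
      Conc.principal_le_iff.2 ((PLCon.isPartialPrelattice _).trans _ _ _
        (PLCon.le_rel _ _ _ (le_inf (f.monotone _ _ (Le.u_le_x _)) (f.monotone _ _ (Le.u_le_y _))))
        (PLCon.principal_rel _ _))
    simpa only [hprin, qdist_u_o] using ψ.monotone hle
  · have hle : Conc.principal (f.toFun x ⊓ f.toFun y) (f.toFun o) ≤
        .principal (f.toFun x) (f.toFun (t ⟨b, hb⟩)) := by
      refine Conc.principal_le_iff.2 (((PLCon.isPartialPrelattice _).inf_of_mem_meet _ _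
        (f.map_meet _ _ (o_mem_meet ⟨b, hb⟩))).2 _ ?_)
      rintro _ ⟨p, rfl | rfl, rfl⟩
      · exact (PLCon.isPartialPrelattice _).trans _ _ _ (PLCon.le_rel _ _ _ inf_le_left)
          (PLCon.principal_rel _ _)
      · exact PLCon.le_rel _ _ _ inf_le_right
    simpa only [hprin, qdist_x_t] using ψ.monotone hle

/-- If every `(∨, 0)`-homomorphism `Con_c P → S` from the compact congruences of a partial lattice
can be lifted, then `S` is a lattice (the binary meets, that are not given, exist) and `S` is
conditionally complete. -/
theorem propositionP (S : Type u) [SemilatticeSup S] [OrderBot S]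
    (h : ∀ (P : Type u) [PartialLattice P] (φ : SupBotHom (Conc P) S), CanBeLifted.{u, u, w} φ) :
    (∀ a b : S, ∃ c : S, IsGLB {a, b} c) ∧ IsConditionallyComplete S := by
  have hmeet : ∀ a b : S, ∃ c : S, IsGLB {a, b} c := fun a b => by
    obtain ⟨c, hc₁, hc₂⟩ := exists_between_of_canBeLifted h (A := lowerBounds {a, b}) (B := {a, b})
      (e := a ⊔ b) (fun s hs => (hs (Set.mem_insert a _)).trans le_sup_left)
      (by simp) (fun s hs t ht => hs ht)
    exact ⟨c, hc₂, hc₁⟩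
  refine ⟨hmeet, fun X hX => ?_⟩
  rintro ⟨e, he⟩
  obtain ⟨c, hc₁, hc₂⟩ := exists_between_of_canBeLifted h (A := X) (B := {b ∈ upperBounds X | b ≤ e})
    he (fun b hb => hb.2) (fun a ha b hb => hb.1 ha)
  refine ⟨c, hc₁, fun b hb => ?_⟩
  obtain ⟨m, hm⟩ := hmeet b e
  refine (hc₂ m ⟨fun a ha => hm.2 ?_, hm.1 (by simp)⟩).trans (hm.1 (by simp))
  rintro s (rfl | rfl)
  exacts [hb ha, he ha]
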